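/- Let $n\in\mathbb N$ and let $\mathcal G$ be a strongly connected weighted digraph on the nodes $1,\dots,n$ with weighted adjacency matrix $A=[a_{ij}]$, where $a_{ij}\ge 0$, $a_{ii}=0$, and $a_{ij}>0$ if and only if there is an edge from $j$ to $i$. Let $L=\Delta-A$ be its Laplacian, where $\Delta$ is the diagonal matrix with $\Delta_{ii}=\sum_{j=1}^n a_{ij}$. For $i=1,\dots,n$ let $f_i:\mathbb R\to\mathbb R$ be a nondecreasing, possibly discontinuous, function with $\lim_{s\to+\infty}|f_i(s)|=\infty$. For $s\in\mathbb R$ let $$\mathcal F[f_i](s)=\bigcap_{\delta>0}\ \bigcap_{\mu(S)=0}\overline{\mathrm{co}}\,\{f_i(B(s,\delta)\setminus S)\}$$ be the Filippov set-valued map of $f_i$, where $\mu$ is Lebesgue measure and $\overline{\mathrm{co}}$ is the closed convex hull. Put $$\mathcal D_1=\Big\{x\in\mathbb R^n \ \Big|\ \exists a\in\mathbb R:\ a\mathbf 1_n\in \prod_{i=1}^n\mathcal F[f_i](x_i)\Big\}.$$ Then every Filippov solution of the nonlinear consensus protocol $\dot x=-Lf(x)$, understood as the differential inclusion $$\dot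 x(t)\in -L\prod_{i=1}^n\mathcal F[f_i](x_i(t)),$$ that is, every function $x:[0,\infty)\to\mathbb R^n$ which is absolutely continuous on each $[0,T]$ and satisfies this inclusion for almost every $t\ge 0$, converges to $\mathcal D_1$: $\ \mathrm{dist}(x(t),\mathcal D_1)\to 0$ as $t\to\infty$. -/

import Mathlib

open Set Filter Topology MeasureTheory

noncomputable section

/-- A weighted digraph on the nodes `V`: an edge relation (`Adj i j` means that there is an edge
from `i` to `j`) and a nonnegative weighted adjacency matrix `A = [a i j]`, with zero diagonal,
such that `a i j > 0` if and only if there is an edge from `j` to `i`. -/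
structure WeightedDigraph (V : Type*) extends Digraph V where
  A : Matrix V V ℝ
  nonneg : ∀ i j, 0 ≤ A i j
  pos_iff_adj : ∀ i j, 0 < A i j ↔ Adj j i
  diag_zero : ∀ i, A i i = 0

namespace WeightedDigraph

variable {V : Type*}

/-- For every two nodes `i`, `j` there is a directed path from `i` to `j`. -/
def StronglyConnected (G : WeightedDigraph V) : Prop :=
  ∀ i j : V, Relation.ReflTransGen G.Adj i j

/-- The in-degree of a node. -/
def inDegree [Fintype V] (G : WeightedDigraph V) (i : V) : ℝ :=
  ∑ j, G.A i j

/-- The graph Laplacian `L = Δ - A`, with `Δ` the diagonal matrix of in-degrees. -/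
def laplacian [Fintype V] [DecidableEq V] (G : WeightedDigraph V) : Matrix V V ℝ :=
  Matrix.diagonal G.inDegree - G.A

end WeightedDigraph

/-- The Filippov set-valued map of `X`: the intersection, over all radii `δ > 0` and all Lebesgue
null sets `S`, of the closed convex hulls of `X (B(x, δ) \ S)`. -/
def filippovMap {E F : Type*} [PseudoMetricSpace E] [MeasureSpace E]
    [NormedAddCommGroup F] [NormedSpace ℝ F] (X : E → F) (x : E) : Set F :=
  ⋂ (δ : ℝ) (_ : 0 < δ) (S : Set E) (_ : volume S = 0),
    closedConvexHull ℝ (X '' (Metric.ball x δ \ S))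

/-- The product of the Filippov sets of the components, `∏ i, F[f i](x i)`. -/
def filippovProd {n : ℕ} (f : Fin n → ℝ → ℝ) (x : EuclideanSpace ℝ (Fin n)) :
    Set (Fin n → ℝ) :=
  Set.univ.pi fun i => filippovMap (f i) (x i)

/-- The right-hand side `-L ∏ i, F[f i](x i)` of the differential inclusion. -/
def measurementField {n : ℕ} (G : WeightedDigraph (Fin n)) (f : Fin n → ℝ → ℝ)
    (x : EuclideanSpace ℝ (Fin n)) : Set (EuclideanSpace ℝ (Fin n)) :=
  (fun u : Fin n → ℝ => WithLp.toLp 2 (-(G.laplacian.mulVec u))) '' filippovProd f x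

/-- `x` is a solution on `[0, ∞)` of the differential inclusion `x' ∈ K (x)`: it is absolutely
continuous on every compact interval `[0, T]` and satisfies the inclusion at almost every time.
Only the values of `x` on `[0, ∞)` matter. -/
def IsInclusionSolution {E : Type*} [NormedAddCommGroup E] [NormedSpace ℝ E]
    (K : E → Set E) (x : ℝ → E) : Prop :=
  (∀ T : ℝ, 0 < T → AbsolutelyContinuousOnInterval x 0 T) ∧
    ∀ᵐ t : ℝ, 0 < t → ∃ v ∈ K (x t), HasDerivAt x v t

/-- The set of all `x` such that some constant vector `a • 1` lies in `∏ i, F[f i](x i)`. -/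
def consensusSet {n : ℕ} (f : Fin n → ℝ → ℝ) : Set (EuclideanSpace ℝ (Fin n)) :=
  {x | ∃ a : ℝ, (fun _ : Fin n => a) ∈ filippovProd f x}

end

/-! Lyapunov argument with a convex, possibly nonsmooth energy. Strong connectivity gives a positive
`σ` with `σᵀ L = 0`; put `E(x) = ∑ σ i * F i (x i)`, `F i` a primitive of `f i`. Filippov values are
subgradients of `F i`, so for almost every `t`, with `u` the selection driving the solution, `E' =
-∑ σ i * u i * (L u) i`. By balance this is minus the disagreement, which vanishes only for constant
`u`. Growth is assumed only at `+∞`, so `E` controls only the positive parts of the coordinates;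
conservation of `∑ σ i * x i` then controls the negative parts. Hence the solution is bounded and
Lipschitz (`exists_bound`, `exists_lipschitz`). Near a point outside the consensus set the
disagreement is bounded below (`exists_disagreement_gap`). If such a point were a limit point, each
visit near it would last a fixed time and cost a fixed amount of energy, although the energy is
bounded below. Compactness turns this into convergence to the set. -/

/-! ### Filippov maps of monotone functions -/

/-- The Filippov set of a monotone real function at `x` is the interval between its one-sided
limits. -/
theorem mem_filippovMap_iff {f : ℝ → ℝ} (hf : Monotone f) {x ξ : ℝ} :
    ξ ∈ filippovMap f x ↔ (∀ y, x < y → ξ ≤ f y) ∧ ∀ y, y < x → f y ≤ ξ := by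
  constructor
  · intro h
    simp only [filippovMap, mem_iInter] at h
    constructor
    · intro y hy
      have h1 := h (y - x) (sub_pos.2 hy) ∅ measure_empty
      refine closedConvexHull_min (t := Iic (f y)) ?_ (convex_Iic _) isClosed_Iic h1
      rintro _ ⟨z, ⟨hz, -⟩, rfl⟩
      rw [Metric.mem_ball, Real.dist_eq, abs_lt] at hz
      exact hf (by linarith)
    · intro y hy
      have h1 := h (x - y) (sub_pos.2 hy) ∅ measure_empty
      refine closedConvexHull_min (t := Ici (f y)) ?_ (convex_Ici _) isClosed_Ici h1
      rintro _ ⟨z, ⟨hz, -⟩, rfl⟩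
      rw [Metric.mem_ball, Real.dist_eq, abs_lt] at hz
      exact hf (by linarith)
  · rintro ⟨h1, h2⟩
    simp only [filippovMap, mem_iInter]
    intro δ hδ S hS
    -- A null set contains no interval, so a point survives on each side of `x`; `ξ` lies between
    -- the two values.
    have key : ∀ a b : ℝ, a < b → ∃ y ∈ Ioo a b, y ∉ S := by
      intro a b hab
      by_contra! hcon
      have h3 := measure_mono_null (fun y hy => hcon y hy) hS
      simp only [Real.volume_Ioo, ENNReal.ofReal_eq_zero] at h3
      linarith
    obtain ⟨y, ⟨hy1, hy2⟩, hyS⟩ := key (x - δ) x (by linarith)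
    obtain ⟨z, ⟨hz1, hz2⟩, hzS⟩ := key x (x + δ) (by linarith)
    have hyI : f y ∈ f '' (Metric.ball x δ \ S) := by
      refine ⟨y, ⟨?_, hyS⟩, rfl⟩
      rw [Metric.mem_ball, Real.dist_eq, abs_lt]
      constructor <;> linarith
    have hzI : f z ∈ f '' (Metric.ball x δ \ S) := by
      refine ⟨z, ⟨?_, hzS⟩, rfl⟩
      rw [Metric.mem_ball, Real.dist_eq, abs_lt]
      constructor <;> linarith
    have hseg := (convex_closedConvexHull (𝕜 := ℝ)
      (s := f '' (Metric.ball x δ \ S))).segment_subset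
      (subset_closedConvexHull hyI) (subset_closedConvexHull hzI)
    have h3 := h2 y hy2
    have h4 := h1 z hz1
    rw [segment_eq_Icc (h3.trans h4)] at hseg
    exact hseg ⟨h3, h4⟩

theorem self_mem_filippovMap {f : ℝ → ℝ} (hf : Monotone f) (x : ℝ) : f x ∈ filippovMap f x :=
  (mem_filippovMap_iff hf).2 ⟨fun _ h => hf h.le, fun _ h => hf h.le⟩

/-- The graph of the Filippov map of a monotone function is closed. -/
theorem filippovMap_closed_graph {f : ℝ → ℝ} (hf : Monotone f) {x ξ : ℕ → ℝ} {x₀ ξ₀ : ℝ}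
    (hx : Tendsto x atTop (𝓝 x₀)) (hξ : Tendsto ξ atTop (𝓝 ξ₀))
    (h : ∀ k, ξ k ∈ filippovMap f (x k)) : ξ₀ ∈ filippovMap f x₀ := by
  simp only [mem_filippovMap_iff hf] at h ⊢
  constructor
  · intro y hy
    exact le_of_tendsto hξ ((hx.eventually_lt_const hy).mono fun k hk => (h k).1 y hk)
  · intro y hy
    exact ge_of_tendsto hξ ((hx.eventually_const_lt hy).mono fun k hk => (h k).2 y hk)

/-- The margin `1` is needed because `f` may jump at `±R`, where Filippov values can exceed `f
(±R)`. -/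
theorem abs_le_of_mem_filippovMap {f : ℝ → ℝ} (hf : Monotone f) {x ξ R : ℝ} (hx : |x| ≤ R)
    (h : ξ ∈ filippovMap f x) : |ξ| ≤ max |f (R + 1)| |f (-(R + 1))| := by
  rw [mem_filippovMap_iff hf] at h
  rw [abs_le] at hx
  have h1 := h.1 (R + 1) (by linarith)
  have h2 := h.2 (-(R + 1)) (by linarith)
  rw [abs_le]
  have h3 := neg_abs_le (f (-(R + 1)))
  have h4 := le_abs_self (f (R + 1))
  have h5 := le_max_left |f (R + 1)| |f (-(R + 1))|
  have h6 := le_max_right |f (R + 1)| |f (-(R + 1))|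
  constructor <;> linarith

/-! ### The potential of a monotone function -/

/-- The primitive of `f` vanishing at `0`. -/
noncomputable def potential (f : ℝ → ℝ) (s : ℝ) : ℝ := ∫ τ in (0 : ℝ)..s, f τ

theorem potential_sub {f : ℝ → ℝ} (hf : Monotone f) (s t : ℝ) :
    potential f t - potential f s = ∫ τ in s..t, f τ :=
  intervalIntegral.integral_interval_sub_left hf.intervalIntegrable hf.intervalIntegrable

/-- Elements of the Filippov set are subgradients of the potential. -/
theorem potential_subgradient {f : ℝ → ℝ} (hf : Monotone f) {s ξ : ℝ}
    (h : ξ ∈ filippovMap f s) (t : ℝ) : ξ * (t - s) ≤ potential f t - potential f s := by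
  rw [mem_filippovMap_iff hf] at h
  rw [potential_sub hf]
  rcases le_total s t with hst | hst
  · have := intervalIntegral.integral_mono_on_of_le_Ioo hst
      (intervalIntegrable_const (c := ξ) (μ := volume)) hf.intervalIntegrable
      fun τ hτ => h.1 τ hτ.1
    rw [intervalIntegral.integral_const, smul_eq_mul] at this
    linarith
  · have := intervalIntegral.integral_mono_on_of_le_Ioo hst hf.intervalIntegrable
      (intervalIntegrable_const (c := ξ) (μ := volume))
      fun τ hτ => h.2 τ hτ.2
    rw [intervalIntegral.integral_const, smul_eq_mul] at this
    rw [intervalIntegral.integral_symm]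
    linarith

theorem abs_potential_sub_le {f : ℝ → ℝ} (hf : Monotone f) {R s t : ℝ} (hs : |s| ≤ R)
    (ht : |t| ≤ R) :
    |potential f t - potential f s| ≤ max |f (R + 1)| |f (-(R + 1))| * |t - s| := by
  have h1 := potential_subgradient hf (self_mem_filippovMap hf s) t
  have h2 := potential_subgradient hf (self_mem_filippovMap hf t) s
  have h3 := abs_le_of_mem_filippovMap hf hs (self_mem_filippovMap hf s)
  have h4 := abs_le_of_mem_filippovMap hf ht (self_mem_filippovMap hf t)
  have h5 := mul_le_mul_of_nonneg_right h3 (abs_nonneg (t - s))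
  have h6 := mul_le_mul_of_nonneg_right h4 (abs_nonneg (t - s))
  rw [← abs_mul] at h5 h6
  have h7 := (abs_le.1 h5).1
  have h8 := (abs_le.1 h6).2
  rw [abs_le]
  constructor <;> linarith

/-- Chain rule: a derivative of `potential f ∘ y`, where it exists, is `ξ * y'` for every
Filippov selection `ξ`. -/
theorem deriv_potential_comp {f : ℝ → ℝ} (hf : Monotone f) {y : ℝ → ℝ} {t v ξ : ℝ}
    (hy : HasDerivAt y v t) (hξ : ξ ∈ filippovMap f (y t))
    (hd : DifferentiableAt ℝ (fun s => potential f (y s)) t) :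
    HasDerivAt (fun s => potential f (y s)) (ξ * v) t := by
  -- The subgradient inequality touches at `s = t`, so Fermat's rule applies even where `potential
  -- f` has a kink at `y t`.
  have hmin : IsLocalMin (fun s => potential f (y s) - ξ * y s) t :=
    Filter.Eventually.of_forall fun s => by
      have := potential_subgradient hf hξ (y s)
      linarith
  have h0 := hmin.hasDerivAt_eq_zero (hd.hasDerivAt.sub (hy.const_mul ξ))
  have h1 := hd.hasDerivAt
  rwa [sub_eq_zero.1 h0] at h1

/-- If `f` is unbounded above then `potential f s - m * s` dominates the positive part of `s`. -/
theorem exists_posPart_le_potential {f : ℝ → ℝ} (hf : Monotone f)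
    (hlim : Tendsto (fun s => |f s|) atTop atTop) {m : ℝ} (hm : f 0 ≤ m) :
    ∃ C, ∀ s, max s 0 ≤ potential f s - m * s + C := by
  obtain ⟨s₀, hs₀, h0⟩ : ∃ s₀, m + 1 ≤ f s₀ ∧ 0 ≤ s₀ := by
    -- The threshold exceeds `|f 0|`, and `f s ≥ f 0`, so a large `|f s|` must come from a positive
    -- `f s`.
    have := (hlim.eventually_ge_atTop (|f 0| + |m| + 1)).and (eventually_ge_atTop 0)
    obtain ⟨s, h1, h2⟩ := this.exists
    refine ⟨s, ?_, h2⟩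
    have h3 := hf h2
    have h4 := le_abs_self m
    have h5 := neg_abs_le (f 0)
    have h6 := abs_nonneg m
    rcases abs_cases (f s) with ⟨h, _⟩ | ⟨h, _⟩ <;> linarith [abs_nonneg (f 0)]
  have hpot : potential f 0 = 0 := by simp [potential]
  -- Supporting lines: at `0` the slope is at most `m`, which settles `s ≤ 0`; at `s₀` it is at
  -- least `m + 1`, which settles `s ≥ 0`.
  refine ⟨max 0 (f s₀ * s₀ - potential f s₀), fun s => ?_⟩
  rcases le_total s 0 with hs | hs
  · have h1 := potential_subgradient hf (self_mem_filippovMap hf 0) s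
    have h2 := mul_le_mul_of_nonpos_right hm hs
    rw [max_eq_right hs]
    have := le_max_left 0 (f s₀ * s₀ - potential f s₀)
    rw [hpot] at h1
    linarith
  · have h1 := potential_subgradient hf (self_mem_filippovMap hf s₀) s
    have h2 := mul_le_mul_of_nonneg_right hs₀ hs
    rw [max_eq_left hs]
    have := le_max_right 0 (f s₀ * s₀ - potential f s₀)
    linarith

/-! ### Absolutely continuous functions -/

theorem AbsolutelyContinuousOnInterval.of_dist_le_mul {X Y : Type*} [PseudoMetricSpace X]
    [PseudoMetricSpace Y] {f : ℝ → X} {g : ℝ → Y} {a b : ℝ} (K : ℝ)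
    (hf : AbsolutelyContinuousOnInterval f a b)
    (h : ∀ s ∈ uIcc a b, ∀ t ∈ uIcc a b, dist (g s) (g t) ≤ K * dist (f s) (f t)) :
    AbsolutelyContinuousOnInterval g a b := by
  have hK := Tendsto.const_mul K hf
  rw [mul_zero] at hK
  refine squeeze_zero' (Eventually.of_forall fun E => Finset.sum_nonneg fun _ _ => dist_nonneg)
    ?_ hK
  refine eventually_inf_principal.2 (Eventually.of_forall fun E hE => ?_)
  rw [Finset.mul_sum]
  exact Finset.sum_le_sum fun i hi => h _ (hE.1 i hi).1 _ (hE.1 i hi).2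

theorem AbsolutelyContinuousOnInterval.finset_sum {ι : Type*} (s : Finset ι) {g : ι → ℝ → ℝ}
    {a b : ℝ} (h : ∀ i ∈ s, AbsolutelyContinuousOnInterval (g i) a b) :
    AbsolutelyContinuousOnInterval (fun t => ∑ i ∈ s, g i t) a b := by
  classical
  induction s using Finset.induction_on with
  | empty =>
    simp only [Finset.sum_empty]
    exact (LipschitzWith.const (0 : ℝ)).lipschitzOnWith.absolutelyContinuousOnInterval
  | insert i s hi ih =>
    simp only [Finset.sum_insert hi]
    exact (h i (Finset.mem_insert_self i s)).fun_add
      (ih fun j hj => h j (Finset.mem_insert_of_mem hj))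

theorem AbsolutelyContinuousOnInterval.sub_le_of_deriv_le {g : ℝ → ℝ} {a b C : ℝ} (hab : a ≤ b)
    (hg : AbsolutelyContinuousOnInterval g a b)
    (h : ∀ᵐ t, t ∈ Ioo a b → deriv g t ≤ C) : g b - g a ≤ C * (b - a) := by
  rw [← hg.integral_deriv_eq_sub]
  have h1 : ∫ t in a..b, deriv g t ≤ ∫ _ in a..b, C := by
    refine intervalIntegral.integral_mono_ae_restrict hab hg.intervalIntegrable_deriv
      intervalIntegrable_const ?_
    have h2 : volume.restrict (Icc a b) = volume.restrict (Ioo a b) :=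
      Measure.restrict_congr_set Ioo_ae_eq_Icc.symm
    rw [h2]
    exact (ae_restrict_iff' measurableSet_Ioo).2 h
  rw [intervalIntegral.integral_const, smul_eq_mul] at h1
  linarith

/-! ### Laplacians of strongly connected digraphs -/

namespace WeightedDigraph

variable {V : Type*} [Fintype V]

theorem laplacian_mulVec [DecidableEq V] (G : WeightedDigraph V) (u : V → ℝ) (i : V) :
    G.laplacian.mulVec u i = ∑ j, G.A i j * (u i - u j) := by
  simp only [laplacian, Matrix.sub_mulVec, Pi.sub_apply, Matrix.mulVec_diagonal]
  simp only [inDegree, Finset.sum_mul, Matrix.mulVec, dotProduct, mul_sub,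
    Finset.sum_sub_distrib]

/-- `σ` is a left null vector of the Laplacian. -/
def Balanced (G : WeightedDigraph V) (σ : V → ℝ) : Prop :=
  ∀ j, ∑ i, σ i * G.A i j = σ j * G.inDegree j

/-- `L` kills constants, hence is singular, hence has a left kernel as well. -/
theorem exists_balanced_ne_zero [Nonempty V] (G : WeightedDigraph V) :
    ∃ w, w ≠ 0 ∧ G.Balanced w := by
  classical
  have hdet : G.laplacian.det = 0 := by
    rw [← Matrix.exists_mulVec_eq_zero_iff]
    refine ⟨fun _ => 1, fun h => one_ne_zero (congrFun h (Classical.arbitrary V)), ?_⟩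
    ext i
    simp [laplacian_mulVec]
  obtain ⟨w, hw, h⟩ := Matrix.exists_vecMul_eq_zero_iff.2 hdet
  refine ⟨w, hw, fun j => ?_⟩
  have := congrFun h j
  simp only [laplacian, Matrix.vecMul_sub, Pi.sub_apply, Matrix.vecMul_diagonal,
    Pi.zero_apply] at this
  simp only [Matrix.vecMul, dotProduct] at this
  linarith

/-- The triangle inequality gives one inequality per node; both sides have the same total over all
nodes, so each is an equality. -/
theorem Balanced.abs {G : WeightedDigraph V} {w : V → ℝ} (hw : G.Balanced w) :
    G.Balanced fun i => |w i| := by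
  have hd : ∀ j, 0 ≤ G.inDegree j := fun j => Finset.sum_nonneg fun k _ => G.nonneg j k
  have hle : ∀ j ∈ Finset.univ, |w j| * G.inDegree j ≤ ∑ i, |w i| * G.A i j := by
    intro j _
    rw [← abs_of_nonneg (hd j), ← abs_mul, ← hw j]
    refine (Finset.abs_sum_le_sum_abs _ _).trans (le_of_eq (Finset.sum_congr rfl fun i _ => ?_))
    rw [abs_mul, abs_of_nonneg (G.nonneg i j)]
  have hsum : ∑ j, |w j| * G.inDegree j = ∑ j, ∑ i, |w i| * G.A i j := by
    rw [Finset.sum_comm]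
    simp only [inDegree, Finset.mul_sum]
  exact fun j => ((Finset.sum_eq_sum_iff_of_le hle).1 hsum j (Finset.mem_univ j)).symm

/-- The Laplacian of a strongly connected digraph has a positive left null vector. -/
theorem StronglyConnected.exists_balanced_pos {G : WeightedDigraph V}
    (hG : G.StronglyConnected) : ∃ σ : V → ℝ, (∀ i, 0 < σ i) ∧ G.Balanced σ := by
  rcases isEmpty_or_nonempty V with hV | hV
  · exact ⟨fun _ => 1, fun i => hV.elim i, fun i => hV.elim i⟩
  obtain ⟨w, hw, hbal⟩ := G.exists_balanced_ne_zero
  refine ⟨_, fun i => ?_, hbal.abs⟩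
  rw [abs_pos]
  intro hi
  apply hw
  ext j
  -- At a zero of `w`, balance makes a sum of nonnegative terms vanish, so zeros propagate along
  -- edges.
  have hstep : ∀ k l, G.Adj k l → w k = 0 → w l = 0 := by
    intro k l hkl hk
    have h1 := hbal.abs k
    simp only [hk, abs_zero, zero_mul] at h1
    rw [Finset.sum_eq_zero_iff_of_nonneg
      fun i _ => mul_nonneg (abs_nonneg _) (G.nonneg i k)] at h1
    have h2 := h1 l (Finset.mem_univ l)
    have h3 := (G.pos_iff_adj l k).2 hkl
    exact abs_eq_zero.1 ((mul_eq_zero.1 h2).resolve_right h3.ne')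
  have := hG i j
  induction this with
  | refl => exact hi
  | tail _ h ih => exact hstep _ _ h ih

theorem Balanced.sum_mul_laplacian [DecidableEq V] {G : WeightedDigraph V} {σ : V → ℝ}
    (hσ : G.Balanced σ) (u : V → ℝ) : ∑ i, σ i * G.laplacian.mulVec u i = 0 := by
  simp only [laplacian_mulVec, mul_sub, Finset.sum_sub_distrib]
  simp only [← Finset.sum_mul, Finset.mul_sum]
  rw [Finset.sum_comm (f := fun i j => σ i * (G.A i j * u j)), sub_eq_zero]
  refine Finset.sum_congr rfl fun j _ => ?_
  have := hσ j
  rw [inDegree] at this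
  rw [← mul_assoc, ← this, Finset.sum_mul]
  exact Finset.sum_congr rfl fun i _ => by ring

/-- The disagreement of `u`: half the weighted sum of the squared differences along edges. -/
noncomputable def disagreement (G : WeightedDigraph V) (σ u : V → ℝ) : ℝ :=
  2⁻¹ * ∑ i, ∑ j, σ i * G.A i j * (u i - u j) ^ 2

theorem Balanced.sum_mul_mul_laplacian [DecidableEq V] {G : WeightedDigraph V} {σ : V → ℝ}
    (hσ : G.Balanced σ) (u : V → ℝ) :
    ∑ i, σ i * (u i * G.laplacian.mulVec u i) = G.disagreement σ u := by
  -- Uses `u i * (u i - u j) = (u i - u j)² / 2 + (u i² - u j²) / 2`; the last part sums to zero by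
  -- balance.
  have h := hσ.sum_mul_laplacian (fun i => u i ^ 2)
  rw [disagreement, ← add_zero (∑ i, σ i * (u i * G.laplacian.mulVec u i)),
    ← mul_zero (-2⁻¹ : ℝ), ← h]
  simp only [laplacian_mulVec, Finset.mul_sum, ← Finset.sum_add_distrib]
  exact Finset.sum_congr rfl fun i _ => Finset.sum_congr rfl fun j _ => by ring

theorem disagreement_nonneg (G : WeightedDigraph V) {σ : V → ℝ} (hσ : ∀ i, 0 < σ i)
    (u : V → ℝ) : 0 ≤ G.disagreement σ u := by
  refine mul_nonneg (by norm_num) (Finset.sum_nonneg fun i _ => Finset.sum_nonneg fun j _ => ?_)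
  exact mul_nonneg (mul_nonneg (hσ i).le (G.nonneg i j)) (sq_nonneg _)

theorem continuous_disagreement (G : WeightedDigraph V) (σ : V → ℝ) :
    Continuous (G.disagreement σ) := by
  unfold disagreement
  fun_prop

theorem StronglyConnected.eq_const_of_disagreement_nonpos {G : WeightedDigraph V}
    (hG : G.StronglyConnected) {σ u : V → ℝ} (hσ : ∀ i, 0 < σ i)
    (h : G.disagreement σ u ≤ 0) : ∃ a : ℝ, ∀ i, u i = a := by
  have hnn : ∀ i j, 0 ≤ σ i * G.A i j * (u i - u j) ^ 2 := fun i j =>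
    mul_nonneg (mul_nonneg (hσ i).le (G.nonneg i j)) (sq_nonneg _)
  have h0 := le_antisymm h (G.disagreement_nonneg hσ u)
  rw [disagreement, mul_eq_zero, or_iff_right (by norm_num),
    Finset.sum_eq_zero_iff_of_nonneg fun i _ => Finset.sum_nonneg fun j _ => hnn i j] at h0
  have hstep : ∀ i j, G.Adj i j → u i = u j := by
    intro i j hij
    have h1 := (Finset.sum_eq_zero_iff_of_nonneg fun k _ => hnn j k).1
      (h0 j (Finset.mem_univ j)) i (Finset.mem_univ i)
    have h2 := mul_pos (hσ j) ((G.pos_iff_adj j i).2 hij)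
    have h3 := pow_eq_zero_iff (two_ne_zero) |>.1 ((mul_eq_zero.1 h1).resolve_left h2.ne')
    linarith
  rcases isEmpty_or_nonempty V with hV | ⟨⟨i⟩⟩
  · exact ⟨0, fun i => hV.elim i⟩
  · refine ⟨u i, fun j => ?_⟩
    have := hG i j
    induction this with
    | refl => rfl
    | tail _ h ih => rw [← hstep _ _ h, ih]

end WeightedDigraph

/-! ### The consensus dynamics -/

section Trajectory

variable {V : Type*} [Fintype V]

/-- The weighted sum of the potentials of the coordinates. -/
noncomputable def energy (σ : V → ℝ) (f : V → ℝ → ℝ) (z : V → ℝ) : ℝ :=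
  ∑ i, σ i * potential (f i) (z i)

/-- On the level sets of a weighted sum of the coordinates, the energy is coercive. -/
theorem exists_bound_of_energy_le {f : V → ℝ → ℝ} (hmono : ∀ i, Monotone (f i))
    (hlim : ∀ i, Tendsto (fun s => |f i s|) atTop atTop) {σ : V → ℝ} (hσ : ∀ i, 0 < σ i)
    (c E : ℝ) :
    ∃ R, ∀ z : V → ℝ, ∑ i, σ i * z i = c → energy σ f z ≤ E → ∀ i, |z i| ≤ R := by
  obtain ⟨m, hm⟩ : ∃ m, ∀ i, f i 0 ≤ m :=
    ⟨∑ i, |f i 0|, fun i => (le_abs_self _).trans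
      (Finset.single_le_sum (f := fun i => |f i 0|) (fun _ _ => abs_nonneg _)
        (Finset.mem_univ i))⟩
  choose C hC using fun i => exists_posPart_le_potential (hmono i) (hlim i) (hm i)
  set P := E - m * c + ∑ i, σ i * C i
  have hR : ∀ i, 0 ≤ (|P| + |P - c|) / σ i := fun i => div_nonneg (by positivity) (hσ i).le
  refine ⟨∑ i, (|P| + |P - c|) / σ i, fun z hz hE i => ?_⟩
  refine le_trans ?_ (Finset.single_le_sum (f := fun i => (|P| + |P - c|) / σ i)
    (fun i _ => hR i) (Finset.mem_univ i))
  have hpos : ∑ i, σ i * max (z i) 0 ≤ P := by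
    have h1 : ∑ i, σ i * max (z i) 0 ≤
        ∑ i, σ i * (potential (f i) (z i) - m * z i + C i) :=
      Finset.sum_le_sum fun i _ => mul_le_mul_of_nonneg_left (hC i (z i)) (hσ i).le
    have h2 : ∑ i, σ i * (potential (f i) (z i) - m * z i + C i) =
        energy σ f z - m * ∑ i, σ i * z i + ∑ i, σ i * C i := by
      rw [energy, Finset.mul_sum, ← Finset.sum_sub_distrib, ← Finset.sum_add_distrib]
      exact Finset.sum_congr rfl fun i _ => by ring
    rw [h2, hz] at h1
    linarith
  -- Negative part equals positive part minus `z i`, and the weighted sum of the `z i` is fixed.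
  have hneg : ∑ i, σ i * max (-z i) 0 ≤ P - c := by
    have h1 : ∑ i, σ i * max (-z i) 0 = ∑ i, σ i * max (z i) 0 - ∑ i, σ i * z i := by
      rw [← Finset.sum_sub_distrib]
      refine Finset.sum_congr rfl fun i _ => ?_
      rw [← mul_sub]
      congr 1
      rcases le_total (z i) 0 with h | h
      · rw [max_eq_right h, max_eq_left (by linarith)]; ring
      · rw [max_eq_left h, max_eq_right (by linarith)]; ring
    rw [h1, hz]
    linarith
  have h1 := (Finset.single_le_sum (f := fun i => σ i * max (z i) 0)
    (fun i _ => mul_nonneg (hσ i).le (le_max_right _ _)) (Finset.mem_univ i)).trans hpos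
  have h2 := (Finset.single_le_sum (f := fun i => σ i * max (-z i) 0)
    (fun i _ => mul_nonneg (hσ i).le (le_max_right _ _)) (Finset.mem_univ i)).trans hneg
  rw [le_div_iff₀ (hσ i)]
  have h3 : |z i| = max (z i) 0 + max (-z i) 0 := by
    rcases le_total (z i) 0 with h | h
    · rw [max_eq_right h, max_eq_left (by linarith), abs_of_nonpos h]; ring
    · rw [max_eq_left h, max_eq_right (by linarith), abs_of_nonneg h]; ring
  rw [h3]
  have h4 := le_abs_self P
  have h5 := le_abs_self (P - c)
  linarith

/-- Away from consensus points, the disagreement of Filippov selections is bounded below. -/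
theorem exists_disagreement_gap {G : WeightedDigraph V} (hG : G.StronglyConnected)
    {f : V → ℝ → ℝ} (hmono : ∀ i, Monotone (f i)) {σ : V → ℝ} (hσ : ∀ i, 0 < σ i)
    {z₀ : V → ℝ} (hz₀ : ¬∃ a : ℝ, ∀ i, a ∈ filippovMap (f i) (z₀ i)) :
    ∃ r > 0, ∀ z, dist z z₀ < r → ∀ u : V → ℝ, (∀ i, u i ∈ filippovMap (f i) (z i)) →
      r ≤ G.disagreement σ u := by
  -- Otherwise selections at points tending to `z₀` have disagreement tending to `0`; a limit of
  -- them is a constant selection at `z₀`.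
  by_contra! hcon
  choose z hz u hu hlt using fun k : ℕ => hcon (1 / ((k : ℝ) + 1)) Nat.one_div_pos_of_nat
  have hzlim : Tendsto z atTop (𝓝 z₀) := by
    rw [tendsto_iff_dist_tendsto_zero]
    exact squeeze_zero (fun _ => dist_nonneg) (fun k => (hz k).le)
      tendsto_one_div_add_atTop_nhds_zero_nat
  have hcpt : IsCompact (univ.pi fun i => Icc
      (-max |f i (‖z₀‖ + 1 + 1)| |f i (-(‖z₀‖ + 1 + 1))|)
      (max |f i (‖z₀‖ + 1 + 1)| |f i (-(‖z₀‖ + 1 + 1))|)) :=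
    isCompact_univ_pi fun i => isCompact_Icc
  have hmem : ∀ k, u k ∈ univ.pi fun i => Icc
      (-max |f i (‖z₀‖ + 1 + 1)| |f i (-(‖z₀‖ + 1 + 1))|)
      (max |f i (‖z₀‖ + 1 + 1)| |f i (-(‖z₀‖ + 1 + 1))|) := by
    intro k i _
    refine abs_le.1 (abs_le_of_mem_filippovMap (hmono i) ?_ (hu k i))
    have h1 : dist (z k) z₀ < 1 := (hz k).trans_le (by
      rw [div_le_one (by positivity)]
      linarith [k.cast_nonneg (α := ℝ)])
    rw [dist_eq_norm] at h1
    calc |z k i| ≤ ‖z k‖ := norm_le_pi_norm (z k) i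
      _ = ‖z₀ + (z k - z₀)‖ := by rw [add_sub_cancel]
      _ ≤ ‖z₀‖ + ‖z k - z₀‖ := norm_add_le _ _
      _ ≤ ‖z₀‖ + 1 := by linarith
  obtain ⟨u₀, -, φ, hφ, hulim⟩ := hcpt.tendsto_subseq hmem
  have hu₀ : ∀ i, u₀ i ∈ filippovMap (f i) (z₀ i) := fun i =>
    filippovMap_closed_graph (hmono i)
      ((tendsto_pi_nhds.1 (hzlim.comp hφ.tendsto_atTop)) i) (tendsto_pi_nhds.1 hulim i)
      fun k => hu (φ k) i
  have h0 : G.disagreement σ u₀ ≤ 0 :=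
    le_of_tendsto_of_tendsto'
      (((G.continuous_disagreement σ).tendsto u₀).comp hulim)
      (tendsto_one_div_add_atTop_nhds_zero_nat.comp hφ.tendsto_atTop)
      fun k => (hlt (φ k)).le
  obtain ⟨a, ha⟩ := hG.eq_const_of_disagreement_nonpos hσ h0
  exact hz₀ ⟨a, fun i => ha i ▸ hu₀ i⟩

variable [DecidableEq V]

/-- A solution of `y' ∈ -L ∏ i, F[f i](y i)` on `[0, ∞)`, in coordinates. -/
structure IsTrajectory (G : WeightedDigraph V) (f : V → ℝ → ℝ) (y : ℝ → V → ℝ) : Prop where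
  absCont : ∀ T, 0 < T → ∀ i, AbsolutelyContinuousOnInterval (fun t => y t i) 0 T
  ae_hasDerivAt : ∀ᵐ t : ℝ, 0 < t → ∃ u : V → ℝ, (∀ i, u i ∈ filippovMap (f i) (y t i)) ∧
    ∀ i, HasDerivAt (fun t => y t i) (-(G.laplacian.mulVec u i)) t

namespace IsTrajectory

variable {G : WeightedDigraph V} {f : V → ℝ → ℝ} {y : ℝ → V → ℝ} {σ : V → ℝ}

theorem sum_mul_eq (hy : IsTrajectory G f y) (hbal : G.Balanced σ) {t : ℝ} (ht : 0 < t) :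
    ∑ i, σ i * y t i = ∑ i, σ i * y 0 i := by
  have hac : AbsolutelyContinuousOnInterval (fun t => ∑ i, σ i * y t i) 0 t :=
    .finset_sum _ fun i _ => (hy.absCont t ht i).const_mul (σ i)
  have hae : ∀ᵐ s, s ∈ Ioo 0 t → HasDerivAt (fun t => ∑ i, σ i * y t i) 0 s := by
    filter_upwards [hy.ae_hasDerivAt] with s hs hst
    obtain ⟨u, -, hu⟩ := hs hst.1
    have h1 := HasDerivAt.fun_sum fun i (_ : i ∈ Finset.univ) => (hu i).const_mul (σ i)
    simpa only [mul_neg, Finset.sum_neg_distrib, hbal.sum_mul_laplacian, neg_zero] using h1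
  have h1 := hac.sub_le_of_deriv_le (C := 0) ht.le
    (hae.mono fun s hs hst => (hs hst).deriv.le)
  have h2 := hac.fun_neg.sub_le_of_deriv_le (C := 0) ht.le
    (hae.mono fun s hs hst => (hs hst).fun_neg.deriv.le.trans (by simp))
  linarith

theorem absCont_potential (hy : IsTrajectory G f y) (hmono : ∀ i, Monotone (f i)) {T : ℝ}
    (hT : 0 < T) (i : V) :
    AbsolutelyContinuousOnInterval (fun t => potential (f i) (y t i)) 0 T := by
  obtain ⟨R, hR⟩ := (hy.absCont T hT i).exists_bound
  refine (hy.absCont T hT i).of_dist_le_mul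
    (max |f i (R + 1)| |f i (-(R + 1))|) fun s hs t ht => ?_
  exact abs_potential_sub_le (hmono i) (hR t ht) (hR s hs)

/-- The energy decreases at a rate given by the disagreement. -/
theorem energy_sub_le (hy : IsTrajectory G f y) (hmono : ∀ i, Monotone (f i))
    (hbal : G.Balanced σ) {a b r : ℝ} (ha : 0 ≤ a) (hab : a ≤ b)
    (h : ∀ t ∈ Ioo a b, ∀ u : V → ℝ, (∀ i, u i ∈ filippovMap (f i) (y t i)) →
      r ≤ G.disagreement σ u) :
    energy σ f (y b) - energy σ f (y a) ≤ -r * (b - a) := by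
  -- Absolute continuity is available only on `[0, T]` with `T > 0`, while `b = 0` is allowed.
  have hb : 0 < b + 1 := by linarith
  have hsub : uIcc a b ⊆ uIcc 0 (b + 1) := by
    rw [uIcc_of_le hab, uIcc_of_le hb.le]
    exact Icc_subset_Icc ha (by linarith)
  have hp : ∀ i, AbsolutelyContinuousOnInterval (fun t => potential (f i) (y t i)) a b :=
    fun i => (hy.absCont_potential hmono hb i).mono hsub
  have hac : AbsolutelyContinuousOnInterval (fun t => energy σ f (y t)) a b :=
    .finset_sum _ fun i _ => (hp i).const_mul (σ i)
  refine hac.sub_le_of_deriv_le hab ?_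
  filter_upwards [hy.ae_hasDerivAt, ae_all_iff.2 fun i => (hp i).ae_differentiableAt]
    with t ht hd htab
  obtain ⟨u, hu, hv⟩ := ht (ha.trans_lt htab.1)
  have htI : t ∈ uIcc a b := by
    rw [uIcc_of_le hab]
    exact Ioo_subset_Icc_self htab
  have h1 := HasDerivAt.fun_sum fun i (_ : i ∈ Finset.univ) =>
    (deriv_potential_comp (hmono i) (hv i) (hu i) (hd i htI)).const_mul (σ i)
  refine h1.deriv.le.trans ?_
  simp only [mul_neg, Finset.sum_neg_distrib, hbal.sum_mul_mul_laplacian]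
  exact neg_le_neg (h t htab u hu)

theorem exists_bound (hy : IsTrajectory G f y) (hmono : ∀ i, Monotone (f i))
    (hlim : ∀ i, Tendsto (fun s => |f i s|) atTop atTop) (hσ : ∀ i, 0 < σ i)
    (hbal : G.Balanced σ) : ∃ R, ∀ t, 0 < t → ∀ i, |y t i| ≤ R := by
  obtain ⟨R, hR⟩ := exists_bound_of_energy_le hmono hlim hσ (∑ i, σ i * y 0 i)
    (energy σ f (y 0))
  refine ⟨R, fun t ht => hR _ (hy.sum_mul_eq hbal ht) ?_⟩
  have := hy.energy_sub_le hmono hbal le_rfl ht.le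
    fun t _ u _ => G.disagreement_nonneg hσ u
  linarith

/-- On a bounded trajectory the selections, hence the velocities, are bounded. -/
theorem exists_lipschitz (hy : IsTrajectory G f y) (hmono : ∀ i, Monotone (f i)) {R : ℝ}
    (hR : ∀ t, 0 < t → ∀ i, |y t i| ≤ R) :
    ∃ K, 0 ≤ K ∧ ∀ a b, 0 ≤ a → a ≤ b → dist (y b) (y a) ≤ K * (b - a) := by
  set B : V → ℝ := fun i => max |f i (R + 1)| |f i (-(R + 1))|
  have hB0 : ∀ i, 0 ≤ B i := fun i => (abs_nonneg _).trans (le_max_left _ _)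
  set M : V → ℝ := fun i => ∑ j, |G.laplacian i j| * B j
  have hM0 : ∀ i, 0 ≤ M i := fun i =>
    Finset.sum_nonneg fun j _ => mul_nonneg (abs_nonneg _) (hB0 j)
  refine ⟨∑ i, M i, Finset.sum_nonneg fun i _ => hM0 i, fun a b ha hab => ?_⟩
  have hK : ∀ i, M i ≤ ∑ i, M i := fun i =>
    Finset.single_le_sum (fun i _ => hM0 i) (Finset.mem_univ i)
  rw [dist_pi_le_iff (mul_nonneg (Finset.sum_nonneg fun i _ => hM0 i) (sub_nonneg.2 hab))]
  intro i
  refine le_trans ?_ (mul_le_mul_of_nonneg_right (hK i) (sub_nonneg.2 hab))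
  have hb : 0 < b + 1 := by linarith
  have hac : AbsolutelyContinuousOnInterval (fun t => y t i) a b :=
    (hy.absCont (b + 1) hb i).mono <| by
      rw [uIcc_of_le hab, uIcc_of_le hb.le]
      exact Icc_subset_Icc ha (by linarith)
  have hae : ∀ᵐ t, t ∈ Ioo a b → ∃ v, |v| ≤ M i ∧ HasDerivAt (fun t => y t i) v t := by
    filter_upwards [hy.ae_hasDerivAt] with t ht htab
    have ht0 := ha.trans_lt htab.1
    obtain ⟨u, hu, hv⟩ := ht ht0
    refine ⟨_, ?_, hv i⟩
    rw [abs_neg]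
    refine (Finset.abs_sum_le_sum_abs _ _).trans (Finset.sum_le_sum fun j _ => ?_)
    rw [abs_mul]
    exact mul_le_mul_of_nonneg_left
      (abs_le_of_mem_filippovMap (hmono j) (hR t ht0 j) (hu j)) (abs_nonneg _)
  have h1 := hac.sub_le_of_deriv_le (C := M i) hab (hae.mono fun t ht htab => by
    obtain ⟨v, hv, hd⟩ := ht htab
    exact hd.deriv.le.trans ((le_abs_self v).trans hv))
  have h2 := hac.fun_neg.sub_le_of_deriv_le (C := M i) hab (hae.mono fun t ht htab => by
    obtain ⟨v, hv, hd⟩ := ht htab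
    exact hd.fun_neg.deriv.le.trans ((neg_le_abs v).trans hv))
  rw [Real.dist_eq, abs_le]
  constructor <;> linarith

/-- Every limit point of a trajectory at infinity is a consensus point. -/
theorem consensus_of_tendsto (hy : IsTrajectory G f y) (hG : G.StronglyConnected)
    (hmono : ∀ i, Monotone (f i)) (hσ : ∀ i, 0 < σ i) (hbal : G.Balanced σ) {R : ℝ}
    (hR : ∀ t, 0 < t → ∀ i, |y t i| ≤ R) {τ : ℕ → ℝ} (hτ : Tendsto τ atTop atTop)
    {z₀ : V → ℝ} (hz₀ : Tendsto (fun k => y (τ k)) atTop (𝓝 z₀)) :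
    ∃ a : ℝ, ∀ i, a ∈ filippovMap (f i) (z₀ i) := by
  by_contra hcon
  obtain ⟨r, hr, hgap⟩ := exists_disagreement_gap hG hmono hσ hcon
  obtain ⟨K, hK0, hK⟩ := hy.exists_lipschitz hmono hR
  -- Truncating at `1` gives an antitone function on all of `ℝ` that only sees positive times, where
  -- `hR` applies.
  have hmonoE : Antitone fun t => energy σ f (y (max t 1)) := by
    intro s t hst
    have := hy.energy_sub_le hmono hbal (a := max s 1) (b := max t 1) (r := 0)
      (by positivity) (max_le_max_right 1 hst) fun t _ u _ => G.disagreement_nonneg hσ u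
    linarith
  have hbdd : BddBelow (range fun t => energy σ f (y (max t 1))) := by
    refine ⟨∑ i, σ i * -(|f i 0| * R), ?_⟩
    rintro _ ⟨t, rfl⟩
    refine Finset.sum_le_sum fun i _ => mul_le_mul_of_nonneg_left ?_ (hσ i).le
    have h1 := potential_subgradient (hmono i) (self_mem_filippovMap (hmono i) 0)
      (y (max t 1) i)
    have h2 : potential (f i) 0 = 0 := by simp [potential]
    have h3 : |f i 0 * y (max t 1) i| ≤ |f i 0| * R := by
      rw [abs_mul]
      exact mul_le_mul_of_nonneg_left (hR _ (by positivity) i) (abs_nonneg _)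
    have h4 := (abs_le.1 h3).1
    rw [h2, sub_zero, sub_zero] at h1
    linarith
  have hlimE := tendsto_atTop_ciInf hmonoE hbdd
  -- Starting within `r / 2` of `z₀`, the trajectory stays within `r` for time `d`, since `K * d ≤ r
  -- / 2`; `K + 1` covers `K = 0`.
  set d := r / (2 * (K + 1)) with hd
  have hd0 : 0 < d := by positivity
  have hdiff := (hlimE.comp (tendsto_atTop_add_const_right _ d hτ)).sub (hlimE.comp hτ)
  rw [sub_self] at hdiff
  have hdrop : ∀ᶠ k in atTop, energy σ f (y (max (τ k + d) 1)) -
      energy σ f (y (max (τ k) 1)) ≤ -r * d := by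
    filter_upwards [hτ.eventually_ge_atTop 1,
      hz₀.eventually (Metric.ball_mem_nhds z₀ (half_pos hr))] with k hk hball
    rw [max_eq_left hk, max_eq_left (by linarith)]
    have := hy.energy_sub_le hmono hbal (a := τ k) (b := τ k + d) (r := r) (by linarith)
      (by linarith) fun t ht => hgap (y t) (by
        have h1 := hK (τ k) t (by linarith) ht.1.le
        have h2 : K * (t - τ k) ≤ K * d :=
          mul_le_mul_of_nonneg_left (by linarith [ht.2]) hK0
        have h3 : K * d ≤ r / 2 := by
          rw [hd, mul_div_assoc', div_le_div_iff₀ (by positivity) two_pos]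
          nlinarith
        have h4 := dist_triangle (y t) (y (τ k)) z₀
        linarith)
    rwa [add_sub_cancel_left] at this
  have h0 : (0 : ℝ) ≤ -r * d := le_of_tendsto hdiff hdrop
  nlinarith [mul_pos hr hd0]

end IsTrajectory

end Trajectory

theorem IsInclusionSolution.isTrajectory {n : ℕ} {G : WeightedDigraph (Fin n)}
    {f : Fin n → ℝ → ℝ} {x : ℝ → EuclideanSpace ℝ (Fin n)}
    (hx : IsInclusionSolution (measurementField G f) x) :
    IsTrajectory G f fun t => WithLp.ofLp (x t) where
  absCont T hT i := (hx.1 T hT).of_dist_le_mul 1 fun s _ t _ => by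
    rw [one_mul, dist_eq_norm, dist_eq_norm]
    exact PiLp.norm_apply_le (x s - x t) i
  ae_hasDerivAt := by
    filter_upwards [hx.2] with t ht ht0
    obtain ⟨_, ⟨u, hu, rfl⟩, hd⟩ := ht ht0
    refine ⟨u, fun i => hu i (mem_univ i), fun i => ?_⟩
    exact (EuclideanSpace.proj (𝕜 := ℝ) i).hasFDerivAt.comp_hasDerivAt t hd

/-- Every solution of `x' ∈ -L ∏ i, F[f i](x i)` on a strongly connected weighted digraph converges
to the set `consensusSet f`. The extended distance to the empty set is `⊤`, so that the conclusion
is not vacuous. -/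
theorem mainTheorem1 (n : ℕ) (G : WeightedDigraph (Fin n)) (hG : G.StronglyConnected)
    (f : Fin n → ℝ → ℝ) (hmono : ∀ i, Monotone (f i))
    (hlim : ∀ i, Tendsto (fun s => |f i s|) atTop atTop)
    (x : ℝ → EuclideanSpace ℝ (Fin n))
    (hx : IsInclusionSolution (measurementField G f) x) :
    Tendsto (fun t => Metric.infEDist (x t) (consensusSet f)) atTop (𝓝 0) := by
  have hy := hx.isTrajectory
  obtain ⟨σ, hσ, hbal⟩ := hG.exists_balanced_pos
  obtain ⟨R, hR⟩ := hy.exists_bound hmono hlim hσ hbal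
  rw [ENNReal.tendsto_nhds_zero]
  intro ε hε
  -- Otherwise some times tending to infinity keep the distance above `ε`; a convergent subsequence
  -- has its limit in the consensus set.
  by_contra hcon
  obtain ⟨τ, hτ, hτε⟩ := exists_seq_forall_of_frequently
    ((not_eventually.1 hcon).and_eventually (eventually_gt_atTop 0))
  have hmem : ∀ k, WithLp.ofLp (x (τ k)) ∈ univ.pi fun _ : Fin n => Icc (-R) R :=
    fun k i _ => abs_le.1 (hR _ (hτε k).2 i)
  obtain ⟨z₀, -, φ, hφ, hz₀⟩ :=
    (isCompact_univ_pi fun _ : Fin n => isCompact_Icc).tendsto_subseq hmem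
  obtain ⟨a, ha⟩ := hy.consensus_of_tendsto hG hmono hσ hbal hR
    (hτ.comp hφ.tendsto_atTop) hz₀
  have hmemC : WithLp.toLp 2 z₀ ∈ consensusSet f := ⟨a, fun i _ => ha i⟩
  have hlim2 : Tendsto (fun k => x (τ (φ k))) atTop (𝓝 (WithLp.toLp 2 z₀)) :=
    ((PiLp.continuous_toLp 2 _).tendsto z₀).comp hz₀
  obtain ⟨k, hk⟩ := (hlim2.eventually (Metric.eball_mem_nhds _ hε)).exists
  exact (hτε (φ k)).1 ((Metric.infEDist_le_edist_of_mem hmemC).trans hk.le)
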